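/- Let $L$ be an infinite-dimensional separable complex Hilbert space, $\mathcal B$ the algebra of bounded operators on $L$ with the operator norm, and $\mathcal K\subset\mathcal B$ the ideal of finite rank operators. For $p\in[1,\infty]$ let $\|\cdot\|_p$ be the Schatten $p$-norm on $\mathcal K$ (the $\ell_p$-norm of the sequence of singular numbers; the operator norm if $p=\infty$) and $\mathcal K_p=(\mathcal K,\|\cdot\|_p)$. For a complex linear space $E$ put $\mathcal KE=\mathcal K\otimes E$, with the $\mathcal B$-bimodule operations $a\cdot(c\otimes x)\cdot b=(acb)\otimes x$. A semi-normed $PQ$-space is a complex linear space $E$ with a seminorm on $\mathcal KE$ such that $\|a\cdot u\cdot b\|\le\|a\|\,\|u\|\,\|b\|$ for all $a,b\in\mathcal B$, $u\in\mathcal KE$. A linear isomorphism $\varphi:E\to F$ of semi-normed $PQ$-spaces is a completely isometric isomorphism if $\varphi_\infty:\mathcal KE\to\mathcal KF$, $a\otimes x\mapsto a\otimes\varphi(x)$, is isometric. For $p\in[1,\infty]$ let ${}^{(p)}\mathbb C$ be the $PQ$-space $\mathbb C$ for which $\mathcal K\mathbb C=\mathcal K\otimes\mathbb C$ carries the projective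 tensor norm of $\mathcal K_p\otimes_{pr}\mathbb C$ (so that $\mathcal K\mathbb C$ is identified with $\mathcal K_p$). Fix a unitary isomorphism $\iota$ of the Hilbert tensor square $L\dot\otimes L$ onto $L$ and, for $a,b\in\mathcal B$, let $a\diamond b=\iota(a\dot\otimes b)\iota^{-1}\in\mathcal B$, where $a\dot\otimes b$ is the Hilbert tensor product of operators. For $u\in\mathcal KE$ and $v\in\mathcal KF$ let $u\diamond v\in\mathcal K(E\otimes F)$ be given bilinearly by $(a\otimes x)\diamond(b\otimes y)=(a\diamond b)\otimes(x\otimes y)$. For semi-normed $PQ$-spaces $E,F$ let $E\otimes_{pop}F$ be $E\otimes F$ with the seminorm on $\mathcal K(E\otimes F)$ $$\|U\|_{pop}=\inf\Big\{\sum_{k=1}^n\|a_k\|\,\|u_k\|\,\|v_k\|\,\|b_k\| : U=\sum_{k=1}^n a_k\cdot(u_k\diamond v_k)\cdot b_k\Big\},$$ where $n\ge 0$, $a_k,b_k\in\mathcal B$, $u_k\in\mathcal KE$, $v_k\in\mathcal KF$. Then for all $p,q\in[1,\infty]$ one has $${}^{(p)}\mathbb C\otimes_{pop}{}^{(q)}\mathbb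 C={}^{(r)}\mathbb C,\qquad r=\max\{p,q\},$$ completely isometrically: the linear isomorphism $\mathbb C\otimes\mathbb C\to\mathbb C$, $\lambda\otimes\mu\mapsto\lambda\mu$, is a completely isometric isomorphism of ${}^{(p)}\mathbb C\otimes_{pop}{}^{(q)}\mathbb C$ onto ${}^{(r)}\mathbb C$. -/

import Mathlib

open scoped TensorProduct ENNReal

noncomputable section

namespace PQ

/-! ### Infima over representations

`repNorm value cost U` is the infimum of `∑ k, cost (i k)` over all finite families `i` with
`U = ∑ k, value (i k)`. Both the projective tensor norm and the norm of `⊗_pop` have this form. -/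

section RepNorm

variable {κ V : Type*} [AddCommGroup V]

def repCosts (value : κ → V) (cost : κ → ℝ) (U : V) : Set ℝ :=
  {t | ∃ (n : ℕ) (i : Fin n → κ), U = ∑ k, value (i k) ∧ t = ∑ k, cost (i k)}

def repNorm (value : κ → V) (cost : κ → ℝ) (U : V) : ℝ := sInf (repCosts value cost U)

variable {value : κ → V} {cost : κ → ℝ}

theorem repCosts_bddBelow (hcost : ∀ i, 0 ≤ cost i) (U : V) :
    BddBelow (repCosts value cost U) := by
  refine ⟨0, ?_⟩
  rintro t ⟨n, i, -, rfl⟩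
  exact Finset.sum_nonneg fun k _ => hcost _

theorem repNorm_zero (hcost : ∀ i, 0 ≤ cost i) : repNorm value cost 0 = 0 := by
  refine le_antisymm (csInf_le (repCosts_bddBelow hcost 0) ⟨0, Fin.elim0, by simp, by simp⟩) ?_
  refine Real.sInf_nonneg ?_
  rintro t ⟨n, i, -, rfl⟩
  exact Finset.sum_nonneg fun k _ => hcost _

theorem repCosts_add {U W : V} {s t : ℝ} (hs : s ∈ repCosts value cost U)
    (ht : t ∈ repCosts value cost W) : s + t ∈ repCosts value cost (U + W) := by
  obtain ⟨m, i, rfl, rfl⟩ := hs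
  obtain ⟨n, j, rfl, rfl⟩ := ht
  exact ⟨m + n, Fin.append i j, by simp [Fin.sum_univ_add], by simp [Fin.sum_univ_add]⟩

theorem repNorm_add_le (hcost : ∀ i, 0 ≤ cost i) (hne : ∀ U, (repCosts value cost U).Nonempty)
    (U W : V) : repNorm value cost (U + W) ≤ repNorm value cost U + repNorm value cost W := by
  refine le_of_forall_pos_le_add fun ε hε => ?_
  obtain ⟨s, hs, hs'⟩ := exists_lt_of_csInf_lt (hne U)
    (show sInf (repCosts value cost U) < repNorm value cost U + ε / 2 by
      unfold repNorm; linarith)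
  obtain ⟨t, ht, ht'⟩ := exists_lt_of_csInf_lt (hne W)
    (show sInf (repCosts value cost W) < repNorm value cost W + ε / 2 by
      unfold repNorm; linarith)
  have := csInf_le (repCosts_bddBelow hcost (U + W)) (repCosts_add hs ht)
  unfold repNorm at *
  linarith

theorem repNorm_map_le [Module ℂ V] (hcost : ∀ i, 0 ≤ cost i) (hne : ∀ U, (repCosts value cost U).Nonempty)
    (T : V →ₗ[ℂ] V) {c : ℝ} (hc : 0 ≤ c)
    (hT : ∀ i, ∃ j, T (value i) = value j ∧ cost j ≤ c * cost i) (U : V) :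
    repNorm value cost (T U) ≤ c * repNorm value cost U := by
  choose f hf hf' using hT
  have key : ∀ t ∈ repCosts value cost U, repNorm value cost (T U) ≤ c * t := by
    rintro t ⟨n, i, rfl, rfl⟩
    calc repNorm value cost (T (∑ k, value (i k)))
        ≤ ∑ k, cost (f (i k)) :=
          csInf_le (repCosts_bddBelow hcost _) ⟨n, f ∘ i, by simp [map_sum, hf], rfl⟩
      _ ≤ ∑ k, c * cost (i k) := Finset.sum_le_sum fun k _ => hf' _
      _ = c * ∑ k, cost (i k) := by rw [Finset.mul_sum]
  rcases hc.eq_or_lt with rfl | hc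
  · obtain ⟨t, ht⟩ := hne U
    simpa using key t ht
  · rw [← div_le_iff₀' hc]
    refine le_csInf (hne U) fun t ht => ?_
    rw [div_le_iff₀' hc]
    exact key t ht

/-- `repNorm` as a seminorm, once every vector has a representation. -/
def repSeminorm [Module ℂ V] (value : κ → V) (cost : κ → ℝ) (hcost : ∀ i, 0 ≤ cost i)
    (hne : ∀ U, (repCosts value cost U).Nonempty)
    (hsmul : ∀ (r : ℂ) i, ∃ j, r • value i = value j ∧ cost j ≤ ‖r‖ * cost i) :
    Seminorm ℂ V :=
  Seminorm.ofSMulLE (repNorm value cost) (repNorm_zero hcost) (repNorm_add_le hcost hne)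
    fun r U => by
      exact repNorm_map_le hcost hne (LinearMap.lsmul ℂ V r) (norm_nonneg r) (hsmul r) U

@[simp]
theorem repSeminorm_apply [Module ℂ V] (hcost : ∀ i, 0 ≤ cost i)
    (hne : ∀ U, (repCosts value cost U).Nonempty)
    (hsmul : ∀ (r : ℂ) i, ∃ j, r • value i = value j ∧ cost j ≤ ‖r‖ * cost i) (U : V) :
    repSeminorm value cost hcost hne hsmul U = repNorm value cost U := rfl

end RepNorm

/-! ### Finite rank operators, amplifications and proto-quantum seminorms -/

variable (L : Type*) [NormedAddCommGroup L] [InnerProductSpace ℂ L]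

/-- `𝒦`: the space of bounded operators of finite rank on `L`. -/
def finiteRank : Submodule ℂ (L →L[ℂ] L) where
  carrier := {a | FiniteDimensional ℂ (LinearMap.range (a : L →ₗ[ℂ] L))}
  zero_mem' := by
    change FiniteDimensional ℂ (LinearMap.range (0 : L →ₗ[ℂ] L))
    rw [LinearMap.range_zero]
    infer_instance
  add_mem' := by
    intro a b ha hb
    have ha' : FiniteDimensional ℂ (LinearMap.range (a : L →ₗ[ℂ] L)) := ha
    have hb' : FiniteDimensional ℂ (LinearMap.range (b : L →ₗ[ℂ] L)) := hb
    refine Submodule.finiteDimensional_of_le (S₂ := LinearMap.range (a : L →ₗ[ℂ] L) ⊔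
      LinearMap.range (b : L →ₗ[ℂ] L)) ?_
    rintro _ ⟨x, rfl⟩
    exact Submodule.add_mem_sup ⟨x, rfl⟩ ⟨x, rfl⟩
  smul_mem' := by
    intro c a ha
    have ha' : FiniteDimensional ℂ (LinearMap.range (a : L →ₗ[ℂ] L)) := ha
    refine Submodule.finiteDimensional_of_le (S₂ := LinearMap.range (a : L →ₗ[ℂ] L)) ?_
    rintro _ ⟨x, rfl⟩
    exact ⟨c • x, by simp⟩

/-- The amplification `𝒦E = 𝒦 ⊗ E` of a linear space `E`. -/
abbrev Amp (E : Type*) [AddCommGroup E] [Module ℂ E] : Type _ := finiteRank L ⊗[ℂ] E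

instance (E : Type*) [AddCommGroup E] [Module ℂ E] : AddCommGroup (Amp L E) :=
  TensorProduct.addCommGroup

variable {L}

theorem mem_finiteRank {a : L →L[ℂ] L} :
    a ∈ finiteRank L ↔ FiniteDimensional ℂ (LinearMap.range (a : L →ₗ[ℂ] L)) := Iff.rfl

theorem mul_mul_mem_finiteRank (a b : L →L[ℂ] L) {x : L →L[ℂ] L} (hx : x ∈ finiteRank L) :
    a * x * b ∈ finiteRank L := by
  have hx' : FiniteDimensional ℂ (LinearMap.range (x : L →ₗ[ℂ] L)) := hx
  rw [mem_finiteRank]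
  refine Submodule.finiteDimensional_of_le
    (S₂ := (LinearMap.range (x : L →ₗ[ℂ] L)).map (a : L →ₗ[ℂ] L)) ?_
  rintro _ ⟨y, rfl⟩
  exact ⟨x (b y), ⟨b y, rfl⟩, rfl⟩

/-- `x ↦ a x b` on `𝒦`, for bounded operators `a`, `b`. -/
def sandwich (a b : L →L[ℂ] L) : finiteRank L →ₗ[ℂ] finiteRank L where
  toFun x := ⟨a * x * b, mul_mul_mem_finiteRank a b x.2⟩
  map_add' x y := by ext1; simp [mul_add, add_mul]
  map_smul' c x := by ext1; simp

variable {E F G : Type*} [AddCommGroup E] [Module ℂ E] [AddCommGroup F] [Module ℂ F]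
  [AddCommGroup G] [Module ℂ G]

/-- The bimodule operation `u ↦ a · u · b` on `𝒦E`, given by `a · (x ⊗ e) · b = (a x b) ⊗ e`. -/
def bimul (a b : L →L[ℂ] L) : Amp L E →ₗ[ℂ] Amp L E := (sandwich a b).rTensor E

theorem bimul_tmul (a b : L →L[ℂ] L) (x : finiteRank L) (e : E) :
    bimul a b (x ⊗ₜ[ℂ] e) = sandwich a b x ⊗ₜ[ℂ] e := rfl

theorem bimul_bimul (a b c d : L →L[ℂ] L) (u : Amp L E) :
    bimul a b (bimul c d u) = bimul (a * c) (d * b) u := by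
  induction u using TensorProduct.induction_on with
  | zero => simp
  | add u v hu hv => simp [hu, hv]
  | tmul x e =>
    simp only [bimul_tmul]
    congr 1

variable (L E) in
/-- A proto-quantum seminorm on `E`: a seminorm on `𝒦E` with `‖a · u · b‖ ≤ ‖a‖ ‖u‖ ‖b‖`.
A linear space with such a seminorm is a semi-normed `PQ`-space. -/
structure PQSeminorm extends Seminorm ℂ (Amp L E) where
  contractive' : ∀ (a b : L →L[ℂ] L) (u : Amp L E),
    toSeminorm (bimul a b u) ≤ ‖a‖ * toSeminorm u * ‖b‖

/-- The amplification `φ_∞ : 𝒦E → 𝒦F`, `a ⊗ x ↦ a ⊗ φ x`, of a linear operator `φ : E → F`. -/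
def amplify (φ : E →ₗ[ℂ] F) : Amp L E →ₗ[ℂ] Amp L F := φ.lTensor (finiteRank L)

/-- A linear isomorphism between semi-normed `PQ`-spaces is a completely isometric isomorphism if
its amplification is isometric. -/
def IsCompletelyIsometricIso (N : PQSeminorm L E) (M : PQSeminorm L F) (φ : E ≃ₗ[ℂ] F) : Prop :=
  ∀ u : Amp L E, M.toSeminorm (amplify φ.toLinearMap u) = N.toSeminorm u

/-! ### Schatten norms and the spaces `^{(p)}E` -/

/-- The `n`-th singular number (numbered from `0`) of a bounded operator `a` on `L`: the distance
from `a` to the operators of rank at most `n`. For compact operators on a Hilbert space these are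
the eigenvalues of `(a* a)^{1/2}` in decreasing order, repeated according to multiplicity. -/
def singularNumber (a : L →L[ℂ] L) (n : ℕ) : ℝ :=
  sInf {t | ∃ c : L →L[ℂ] L, (c : L →ₗ[ℂ] L).rank ≤ n ∧ t = ‖a - c‖}

/-- The Schatten norm `‖a‖_p`, for `p ∈ [1, ∞]`, of a finite rank operator. -/
def schattenNorm (p : ℝ≥0∞) (a : finiteRank L) : ℝ :=
  if p = ∞ then ‖(a : L →L[ℂ] L)‖
  else (∑' n, singularNumber (a : L →L[ℂ] L) n ^ p.toReal) ^ (1 / p.toReal)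

theorem singularNumber_set_bddBelow (a : L →L[ℂ] L) (n : ℕ) :
    BddBelow {t | ∃ c : L →L[ℂ] L, (c : L →ₗ[ℂ] L).rank ≤ n ∧ t = ‖a - c‖} :=
  ⟨0, by rintro t ⟨c, -, rfl⟩; exact norm_nonneg _⟩

theorem singularNumber_nonneg (a : L →L[ℂ] L) (n : ℕ) : 0 ≤ singularNumber a n :=
  Real.sInf_nonneg (by rintro t ⟨c, -, rfl⟩; exact norm_nonneg _)

theorem singularNumber_eq_zero (a : finiteRank L) {n : ℕ}
    (hn : Module.finrank ℂ (LinearMap.range ((a : L →L[ℂ] L) : L →ₗ[ℂ] L)) ≤ n) :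
    singularNumber (a : L →L[ℂ] L) n = 0 := by
  have ha : FiniteDimensional ℂ (LinearMap.range ((a : L →L[ℂ] L) : L →ₗ[ℂ] L)) := a.2
  refine le_antisymm (csInf_le (singularNumber_set_bddBelow _ n) ⟨a, ?_, by simp⟩)
    (singularNumber_nonneg _ _)
  rw [LinearMap.rank, ← Module.finrank_eq_rank]
  exact_mod_cast hn

theorem singularNumber_sandwich_le (a b x : L →L[ℂ] L) (n : ℕ) :
    singularNumber (a * x * b) n ≤ ‖a‖ * ‖b‖ * singularNumber x n := by
  have key : ∀ t ∈ {t | ∃ c : L →L[ℂ] L, (c : L →ₗ[ℂ] L).rank ≤ n ∧ t = ‖x - c‖},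
      singularNumber (a * x * b) n ≤ ‖a‖ * ‖b‖ * t := by
    rintro t ⟨c, hc, rfl⟩
    have h1 : singularNumber (a * x * b) n ≤ ‖a * x * b - a * c * b‖ := by
      refine csInf_le (singularNumber_set_bddBelow _ n) ⟨a * c * b, ?_, rfl⟩
      have e : ((a * c * b : L →L[ℂ] L) : L →ₗ[ℂ] L)
          = (a : L →ₗ[ℂ] L) ∘ₗ ((c : L →ₗ[ℂ] L) ∘ₗ (b : L →ₗ[ℂ] L)) := rfl
      rw [e]
      exact ((LinearMap.rank_comp_le_right _ _).trans (LinearMap.rank_comp_le_left _ _)).trans hc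
    have e2 : a * x * b - a * c * b = a * (x - c) * b := by noncomm_ring
    rw [e2] at h1
    calc _ ≤ _ := h1
      _ ≤ ‖a‖ * ‖x - c‖ * ‖b‖ :=
        (norm_mul_le _ _).trans (mul_le_mul_of_nonneg_right (norm_mul_le _ _) (norm_nonneg _))
      _ = _ := by ring
  have hne : {t | ∃ c : L →L[ℂ] L, (c : L →ₗ[ℂ] L).rank ≤ n ∧ t = ‖x - c‖}.Nonempty :=
    ⟨_, 0, by simp, rfl⟩
  rcases (mul_nonneg (norm_nonneg a) (norm_nonneg b)).eq_or_lt with h | h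
  · obtain ⟨t, ht⟩ := hne
    have := key t ht
    rw [← h] at this ⊢
    simpa using this
  · rw [← div_le_iff₀' h]
    refine le_csInf hne fun t ht => ?_
    rw [div_le_iff₀' h]
    exact key t ht

theorem schattenNorm_nonneg (p : ℝ≥0∞) (a : finiteRank L) : 0 ≤ schattenNorm p a := by
  unfold schattenNorm
  split_ifs
  · exact norm_nonneg _
  · exact Real.rpow_nonneg
      (tsum_nonneg fun n => Real.rpow_nonneg (singularNumber_nonneg _ _) _) _

theorem summable_singularNumber_rpow {s : ℝ} (hs : 0 < s) (a : finiteRank L) :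
    Summable fun n => singularNumber (a : L →L[ℂ] L) n ^ s := by
  refine summable_of_ne_finset_zero
    (s := Finset.range (Module.finrank ℂ (LinearMap.range ((a : L →L[ℂ] L) : L →ₗ[ℂ] L))))
    fun n hn => ?_
  rw [singularNumber_eq_zero a (by simpa using hn), Real.zero_rpow hs.ne']

theorem schattenNorm_sandwich_le {p : ℝ≥0∞} (hp : 1 ≤ p) (a b : L →L[ℂ] L) (x : finiteRank L) :
    schattenNorm p (sandwich a b x) ≤ ‖a‖ * ‖b‖ * schattenNorm p x := by
  unfold schattenNorm
  split_ifs with h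
  · calc ‖a * (x : L →L[ℂ] L) * b‖ ≤ ‖a‖ * ‖(x : L →L[ℂ] L)‖ * ‖b‖ :=
        (norm_mul_le _ _).trans (mul_le_mul_of_nonneg_right (norm_mul_le _ _) (norm_nonneg _))
      _ = _ := by ring
  · have hs : 0 < p.toReal := ENNReal.toReal_pos (zero_lt_one.trans_le hp).ne' h
    have hab : 0 ≤ ‖a‖ * ‖b‖ := by positivity
    have hsum : 0 ≤ ∑' n, singularNumber (x : L →L[ℂ] L) n ^ p.toReal :=
      tsum_nonneg fun n => Real.rpow_nonneg (singularNumber_nonneg _ _) _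
    calc (∑' n, singularNumber ((sandwich a b x : finiteRank L) : L →L[ℂ] L) n ^ p.toReal)
          ^ (1 / p.toReal)
        ≤ (∑' n, (‖a‖ * ‖b‖) ^ p.toReal * singularNumber (x : L →L[ℂ] L) n ^ p.toReal)
          ^ (1 / p.toReal) := by
          refine Real.rpow_le_rpow
            (tsum_nonneg fun n => Real.rpow_nonneg (singularNumber_nonneg _ _) _) ?_ (by positivity)
          refine Summable.tsum_le_tsum (fun n => ?_) (summable_singularNumber_rpow hs _)
            ((summable_singularNumber_rpow hs x).mul_left _)
          rw [← Real.mul_rpow hab (singularNumber_nonneg _ _)]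
          exact Real.rpow_le_rpow (singularNumber_nonneg _ _)
            (singularNumber_sandwich_le a b x n) hs.le
      _ = _ := by
          rw [tsum_mul_left, Real.mul_rpow (by positivity) hsum, ← Real.rpow_mul hab,
            mul_one_div_cancel hs.ne', Real.rpow_one]

section Quantization

variable {X : Type*} [NormedAddCommGroup X] [NormedSpace ℂ X]

theorem projective_nonempty (p : ℝ≥0∞) (U : Amp L X) :
    (repCosts (fun i : finiteRank L × X => i.1 ⊗ₜ[ℂ] i.2)
      (fun i => schattenNorm p i.1 * ‖i.2‖) U).Nonempty := by
  induction U using TensorProduct.induction_on with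
  | zero => exact ⟨_, 0, Fin.elim0, by simp, rfl⟩
  | add u v hu hv =>
    obtain ⟨s, hs⟩ := hu
    obtain ⟨t, ht⟩ := hv
    exact ⟨_, repCosts_add hs ht⟩
  | tmul a x => exact ⟨_, 1, fun _ => (a, x), by simp, rfl⟩

variable (L X) in
/-- The `PQ`-space `^{(p)}X` of a normed space `X`, for `p ∈ [1, ∞]`: the amplification `𝒦 ⊗ X`
carries the norm of the projective tensor product `𝒦_p ⊗_pr X`,
`‖U‖ = inf {∑ ‖a_k‖_p ‖x_k‖ : U = ∑ a_k ⊗ x_k}`. -/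
def quantization (p : ℝ≥0∞) (hp : 1 ≤ p) : PQSeminorm L X where
  toSeminorm := repSeminorm (fun i : finiteRank L × X => i.1 ⊗ₜ[ℂ] i.2)
    (fun i => schattenNorm p i.1 * ‖i.2‖)
    (fun i => mul_nonneg (schattenNorm_nonneg p _) (norm_nonneg _))
    (projective_nonempty p)
    (fun r i => ⟨(i.1, r • i.2), by simp, by simp [norm_smul]; apply le_of_eq; ring⟩)
  contractive' a b u := by
    rw [mul_right_comm]
    refine repNorm_map_le (value := fun i : finiteRank L × X => i.1 ⊗ₜ[ℂ] i.2)
      (cost := fun i => schattenNorm p i.1 * ‖i.2‖)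
      (fun i => mul_nonneg (schattenNorm_nonneg p _) (norm_nonneg _))
      (projective_nonempty p) (bimul a b) (by positivity) (fun i => ?_) u
    refine ⟨(sandwich a b i.1, i.2), rfl, ?_⟩
    rw [← mul_assoc]
    exact mul_le_mul_of_nonneg_right (schattenNorm_sandwich_le hp a b i.1) (norm_nonneg _)

end Quantization

/-! ### The operation `◇` and the projective tensor product `⊗_pop`

From here on a unitary isomorphism `ι` of the Hilbert tensor square of `L` (the completion of
`L ⊗ L` in its inner product norm) onto `L` is fixed. -/

variable (ι : UniformSpace.Completion (L ⊗[ℂ] L) ≃ₗᵢ[ℂ] L)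

/-- `a ◇ b = ι (a ⊗ b) ι⁻¹`, for bounded operators `a`, `b` on `L`, where `a ⊗ b` is the tensor
product of operators on the Hilbert tensor square of `L`. -/
def diamondOp (a b : L →L[ℂ] L) : L →L[ℂ] L :=
  (ι.toContinuousLinearEquiv : UniformSpace.Completion (L ⊗[ℂ] L) →L[ℂ] L) ∘L
    (TensorProduct.mapL a b).completion ∘L
      (ι.symm.toContinuousLinearEquiv : L →L[ℂ] UniformSpace.Completion (L ⊗[ℂ] L))

theorem diamondOp_apply (a b : L →L[ℂ] L) (ξ η : L) :
    diamondOp ι a b (ι ((ξ ⊗ₜ[ℂ] η : L ⊗[ℂ] L))) = ι ((a ξ ⊗ₜ[ℂ] b η : L ⊗[ℂ] L)) := by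
  simp [diamondOp]

theorem ext_diamond {A B : L →L[ℂ] L}
    (h : ∀ ξ η : L, A (ι ((ξ ⊗ₜ[ℂ] η : L ⊗[ℂ] L))) = B (ι ((ξ ⊗ₜ[ℂ] η : L ⊗[ℂ] L)))) :
    A = B := by
  ext z
  obtain ⟨w, rfl⟩ := ι.surjective z
  induction w using UniformSpace.Completion.induction_on with
  | hp => exact isClosed_eq (A.continuous.comp ι.continuous) (B.continuous.comp ι.continuous)
  | ih x =>
    induction x using TensorProduct.induction_on with
    | zero => rw [UniformSpace.Completion.coe_zero, map_zero, map_zero, map_zero]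
    | add x y hx hy =>
      rw [UniformSpace.Completion.coe_add, map_add, map_add, map_add, hx, hy]
    | tmul ξ η => exact h ξ η

theorem diamondOp_mem_finiteRank {a b : L →L[ℂ] L} (ha : a ∈ finiteRank L)
    (hb : b ∈ finiteRank L) : diamondOp ι a b ∈ finiteRank L := by
  have ha' : FiniteDimensional ℂ (LinearMap.range (a : L →ₗ[ℂ] L)) := ha
  have hb' : FiniteDimensional ℂ (LinearMap.range (b : L →ₗ[ℂ] L)) := hb
  let j : (L ⊗[ℂ] L) →ₗ[ℂ] L := ι.toLinearEquiv.toLinearMap ∘ₗ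
    (UniformSpace.Completion.toComplₗᵢ (𝕜 := ℂ) (E := L ⊗[ℂ] L)).toLinearMap
  let W : Submodule ℂ L := LinearMap.range (j ∘ₗ TensorProduct.mapIncl
    (LinearMap.range (a : L →ₗ[ℂ] L)) (LinearMap.range (b : L →ₗ[ℂ] L)))
  have hW : IsClosed (W : Set L) := W.closed_of_finiteDimensional
  rw [mem_finiteRank]
  refine Submodule.finiteDimensional_of_le (S₂ := W) ?_
  rintro _ ⟨z, rfl⟩
  obtain ⟨w, rfl⟩ := ι.surjective z
  change diamondOp ι a b (ι w) ∈ (W : Set L)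
  induction w using UniformSpace.Completion.induction_on with
  | hp => exact hW.preimage ((diamondOp ι a b).continuous.comp ι.continuous)
  | ih x =>
    induction x using TensorProduct.induction_on with
    | zero =>
      rw [UniformSpace.Completion.coe_zero, map_zero, map_zero]
      exact W.zero_mem
    | add x y hx hy =>
      rw [UniformSpace.Completion.coe_add, map_add, map_add]
      exact W.add_mem hx hy
    | tmul ξ η =>
      rw [diamondOp_apply]
      exact ⟨(⟨a ξ, ξ, rfl⟩ : LinearMap.range (a : L →ₗ[ℂ] L)) ⊗ₜ[ℂ]
        (⟨b η, η, rfl⟩ : LinearMap.range (b : L →ₗ[ℂ] L)), rfl⟩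

/-- The bilinear operation `(a, b) ↦ a ◇ b` on `𝒦`. -/
def diamond : finiteRank L →ₗ[ℂ] finiteRank L →ₗ[ℂ] finiteRank L :=
  LinearMap.mk₂ ℂ (fun a b => ⟨diamondOp ι a b, diamondOp_mem_finiteRank ι a.2 b.2⟩)
    (fun a a' b => by
      ext1
      refine ext_diamond ι fun ξ η => ?_
      simp [diamondOp_apply, TensorProduct.add_tmul, UniformSpace.Completion.coe_add])
    (fun c a b => by
      ext1
      refine ext_diamond ι fun ξ η => ?_
      simp [diamondOp_apply, ← TensorProduct.smul_tmul'])
    (fun a b b' => by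
      ext1
      refine ext_diamond ι fun ξ η => ?_
      simp [diamondOp_apply, TensorProduct.tmul_add, UniformSpace.Completion.coe_add])
    (fun c a b => by
      ext1
      refine ext_diamond ι fun ξ η => ?_
      simp [diamondOp_apply, TensorProduct.tmul_smul])

/-- The amplification `ρ_∞ : 𝒦E × 𝒦F → 𝒦G`, `(a ⊗ x, b ⊗ y) ↦ (a ◇ b) ⊗ ρ (x, y)`, of a bilinear
operator `ρ : E × F → G`. -/
def amplify₂ (ρ : E →ₗ[ℂ] F →ₗ[ℂ] G) : Amp L E →ₗ[ℂ] Amp L F →ₗ[ℂ] Amp L G :=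
  TensorProduct.curry
    (TensorProduct.map (TensorProduct.lift (diamond ι)) (TensorProduct.lift ρ) ∘ₗ
      (TensorProduct.tensorTensorTensorComm ℂ (finiteRank L) E (finiteRank L) F).toLinearMap)

theorem amplify₂_tmul (ρ : E →ₗ[ℂ] F →ₗ[ℂ] G) (a b : finiteRank L) (x : E) (y : F) :
    amplify₂ ι ρ (a ⊗ₜ[ℂ] x) (b ⊗ₜ[ℂ] y) = diamond ι a b ⊗ₜ[ℂ] ρ x y := by
  simp [amplify₂]

/-- `u ◇ v = ϑ_∞ (u, v)` in `𝒦(E ⊗ F)`, where `ϑ (x, y) = x ⊗ y`. -/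
def diamondAmp : Amp L E →ₗ[ℂ] Amp L F →ₗ[ℂ] Amp L (E ⊗[ℂ] F) :=
  amplify₂ ι (TensorProduct.mk ℂ E F)

/-- For a suitable isometry `S` and rank one `P`, every `c` in `𝒦` is `S* (P ◇ c) S`. -/
theorem exists_compression [CompleteSpace L] [Nontrivial L] :
    ∃ (P : finiteRank L) (S T : L →L[ℂ] L), ∀ c : finiteRank L,
      sandwich T S (diamond ι P c) = c := by
  obtain ⟨e, he⟩ := exists_norm_eq L zero_le_one
  have hP : InnerProductSpace.rankOne ℂ e e ∈ finiteRank L := by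
    rw [mem_finiteRank]
    refine Submodule.finiteDimensional_of_le (S₂ := Submodule.span ℂ {e}) ?_
    rintro _ ⟨z, rfl⟩
    exact Submodule.mem_span_singleton.2 ⟨_, (InnerProductSpace.rankOne_apply e e z).symm⟩
  let S : L →ₗᵢ[ℂ] L :=
    { toLinearMap := ι.toLinearEquiv.toLinearMap ∘ₗ
        (UniformSpace.Completion.toComplₗᵢ (𝕜 := ℂ) (E := L ⊗[ℂ] L)).toLinearMap ∘ₗ
        TensorProduct.mk ℂ L L e
      norm_map' := fun ζ => by simp [he] }
  have hS : ∀ ζ, S.toContinuousLinearMap ζ = ι ((e ⊗ₜ[ℂ] ζ : L ⊗[ℂ] L)) := fun ζ => rfl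
  refine ⟨⟨_, hP⟩, S.toContinuousLinearMap,
    ContinuousLinearMap.adjoint S.toContinuousLinearMap, fun c => ?_⟩
  ext1
  refine ContinuousLinearMap.ext fun ζ => ?_
  have h1 : diamondOp ι (InnerProductSpace.rankOne ℂ e e) c (S.toContinuousLinearMap ζ)
      = S.toContinuousLinearMap ((c : L →L[ℂ] L) ζ) := by
    rw [hS, diamondOp_apply, hS]
    simp [he, inner_self_eq_norm_sq_to_K]
  change ContinuousLinearMap.adjoint S.toContinuousLinearMap
    (diamondOp ι (InnerProductSpace.rankOne ℂ e e) c (S.toContinuousLinearMap ζ)) = _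
  rw [h1]
  refine ext_inner_left ℂ fun v => ?_
  rw [ContinuousLinearMap.adjoint_inner_right]
  exact S.inner_map_map v _

section Pop

variable (N : PQSeminorm L E) (M : PQSeminorm L F)

/-- The element `a · (u ◇ v) · b` of `𝒦(E ⊗ F)`, for `i = (a, u, v, b)`. -/
def popValue (i : (L →L[ℂ] L) × Amp L E × Amp L F × (L →L[ℂ] L)) : Amp L (E ⊗[ℂ] F) :=
  bimul i.1 i.2.2.2 (diamondAmp ι i.2.1 i.2.2.1)

/-- The number `‖a‖ ‖u‖ ‖v‖ ‖b‖`, for `i = (a, u, v, b)`. -/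
def popCost (i : (L →L[ℂ] L) × Amp L E × Amp L F × (L →L[ℂ] L)) : ℝ :=
  ‖i.1‖ * N.toSeminorm i.2.1 * M.toSeminorm i.2.2.1 * ‖i.2.2.2‖

theorem popCost_nonneg (i : (L →L[ℂ] L) × Amp L E × Amp L F × (L →L[ℂ] L)) :
    0 ≤ popCost N M i :=
  mul_nonneg (mul_nonneg (mul_nonneg (norm_nonneg _) (apply_nonneg _ _)) (apply_nonneg _ _))
    (norm_nonneg _)

theorem popCosts_nonempty [CompleteSpace L] (U : Amp L (E ⊗[ℂ] F)) :
    (repCosts (popValue ι) (popCost N M) U).Nonempty := by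
  rcases subsingleton_or_nontrivial L with hL | hL
  · have : U = 0 := by
      induction U using TensorProduct.induction_on with
      | zero => rfl
      | add u v hu hv => rw [hu, hv, add_zero]
      | tmul a x =>
        have ha : a = 0 := by
          ext1
          exact ContinuousLinearMap.ext fun z => Subsingleton.elim _ _
        rw [ha, TensorProduct.zero_tmul]
    exact ⟨_, 0, Fin.elim0, by simp [this], rfl⟩
  obtain ⟨P, S, T, h⟩ := exists_compression ι
  induction U using TensorProduct.induction_on with
  | zero => exact ⟨_, 0, Fin.elim0, by simp, rfl⟩
  | add u v hu hv =>
    obtain ⟨s, hs⟩ := hu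
    obtain ⟨t, ht⟩ := hv
    exact ⟨_, repCosts_add hs ht⟩
  | tmul c w =>
    induction w using TensorProduct.induction_on with
    | zero => exact ⟨_, 0, Fin.elim0, by simp, rfl⟩
    | add u v hu hv =>
      obtain ⟨s, hs⟩ := hu
      obtain ⟨t, ht⟩ := hv
      rw [TensorProduct.tmul_add]
      exact ⟨_, repCosts_add hs ht⟩
    | tmul x y =>
      refine ⟨_, 1, fun _ => (T, P ⊗ₜ[ℂ] x, c ⊗ₜ[ℂ] y, S), ?_, rfl⟩
      simp [popValue, diamondAmp, amplify₂_tmul, bimul_tmul, h]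

/-- The semi-normed `PQ`-space `E ⊗_pop F`: for `U` in `𝒦(E ⊗ F)`, `‖U‖_pop` is the infimum of
`∑ ‖a_k‖ ‖u_k‖ ‖v_k‖ ‖b_k‖` over all representations `U = ∑ a_k · (u_k ◇ v_k) · b_k` with `a_k`,
`b_k` bounded operators on `L`, `u_k` in `𝒦E` and `v_k` in `𝒦F`. -/
def pop [CompleteSpace L] : PQSeminorm L (E ⊗[ℂ] F) where
  toSeminorm := repSeminorm (popValue ι) (popCost N M) (popCost_nonneg N M)
    (popCosts_nonempty ι N M)
    (fun r i => ⟨(i.1, r • i.2.1, i.2.2.1, i.2.2.2), by simp [popValue],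
      by simp only [popCost, map_smul_eq_mul]; apply le_of_eq; ring⟩)
  contractive' a b U := by
    rw [mul_right_comm]
    refine repNorm_map_le (popCost_nonneg N M) (popCosts_nonempty ι N M) (bimul a b)
      (by positivity) (fun i => ?_) U
    refine ⟨(a * i.1, i.2.1, i.2.2.1, i.2.2.2 * b), ?_, ?_⟩
    · simp only [popValue, bimul_bimul]
    · have h0 : 0 ≤ N.toSeminorm i.2.1 * M.toSeminorm i.2.2.1 :=
        mul_nonneg (apply_nonneg _ _) (apply_nonneg _ _)
      calc popCost N M (a * i.1, i.2.1, i.2.2.1, i.2.2.2 * b)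
          = ‖a * i.1‖ * ‖i.2.2.2 * b‖ * (N.toSeminorm i.2.1 * M.toSeminorm i.2.2.1) := by
            simp only [popCost]; ring
        _ ≤ (‖a‖ * ‖i.1‖) * (‖i.2.2.2‖ * ‖b‖) *
            (N.toSeminorm i.2.1 * M.toSeminorm i.2.2.1) := by
            gcongr
            · exact norm_mul_le _ _
            · exact norm_mul_le _ _
        _ = ‖a‖ * ‖b‖ * popCost N M i := by simp only [popCost]; ring

end Pop

end PQ

end

noncomputable section

namespace PQ

/-! ### Singular value decompositions and singular numbers. -/

variable {L : Type*} [NormedAddCommGroup L] [InnerProductSpace ℂ L]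
  {κ κ' : Type*}

/-! Two inequalities are needed, and each norm is an infimum over representations, so each reduces
to a bound on single terms.

The canonical map is contractive because the Schatten norms are submultiplicative for `◇` and
decrease in the exponent: with `r = max p q`, `‖a ◇ b‖_r ≤ ‖a‖_r ‖b‖_r ≤ ‖a‖_p ‖b‖_q`
(`schattenNorm_diamond_le`, `schattenNorm_antitone`). By bilinearity this passes from elementary
tensors to `u ◇ v`, and the bimodule inequality absorbs the outer factors. Submultiplicativity rests
on the fact that the singular numbers of `a ◇ b` are the products of those of `a` and `b`. Since
singular numbers are defined here by approximation, they are first identified with the norms `‖g i‖`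
in an orthogonal decomposition (`IsSingularDecomp`), which exists for every finite rank operator and
is compatible with `◇`.

The inverse is contractive because one factor can be made free of charge. Let `P` be the projection
onto a unit vector `e`, and `S ζ = ι (e ⊗ ζ)`. Then `S` is an isometry and `S* (P ◇ c) S = c`, while
`P` has norm one for every exponent. So `c` costs at most `‖c‖_q`, and by symmetry at most `‖c‖_p`.
The smaller of these is the norm with the larger exponent. -/

theorem norm_sum_smul_sq {g : κ → L} (hg : Pairwise fun i j => inner ℂ (g i) (g j) = 0)
    (s : Finset κ) (c : κ → ℂ) :
    ‖∑ i ∈ s, c i • g i‖ ^ 2 = ∑ i ∈ s, ‖c i‖ ^ 2 * ‖g i‖ ^ 2 := by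
  classical
  have h : inner ℂ (∑ i ∈ s, c i • g i) (∑ i ∈ s, c i • g i)
      = ((∑ i ∈ s, ‖c i‖ ^ 2 * ‖g i‖ ^ 2 : ℝ) : ℂ) := by
    rw [sum_inner]
    push_cast
    refine Finset.sum_congr rfl fun i hi => ?_
    rw [inner_sum, Finset.sum_eq_single i]
    · rw [inner_smul_left, inner_smul_right, inner_self_eq_norm_sq_to_K, ← mul_assoc,
        RCLike.conj_mul]
      simp
    · intro j _ hj
      rw [inner_smul_left, inner_smul_right, hg hj.symm]
      simp
    · exact fun h => absurd hi h
  rw [inner_self_eq_norm_sq_to_K] at h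
  exact Complex.ofReal_injective (by push_cast at h ⊢; exact h)

theorem norm_sum_smul_orthonormal_sq {e : κ → L} (he : Orthonormal ℂ e) (s : Finset κ)
    (c : κ → ℂ) : ‖∑ i ∈ s, c i • e i‖ ^ 2 = ∑ i ∈ s, ‖c i‖ ^ 2 := by
  rw [norm_sum_smul_sq (fun i j hij => he.2 hij)]
  simp [he.1]

variable [Fintype κ] [Fintype κ']

/-- `a = ∑ i, ⟪e i, ·⟫ g i` with `e` orthonormal and the `g i` pairwise orthogonal. The numbers
`‖g i‖` are then the singular numbers of `a`, up to order and zeros. -/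
structure IsSingularDecomp (a : L →L[ℂ] L) (e g : κ → L) : Prop where
  orthonormal : Orthonormal ℂ e
  orthogonal : Pairwise fun i j => inner ℂ (g i) (g j) = 0
  apply_eq : ∀ x, a x = ∑ i, inner ℂ (e i) x • g i

namespace IsSingularDecomp

variable {a : L →L[ℂ] L} {e g : κ → L}

theorem apply_left (h : IsSingularDecomp a e g) (i : κ) : a (e i) = g i := by
  classical
  rw [h.apply_eq, Finset.sum_eq_single i]
  · simp [inner_self_eq_norm_sq_to_K, h.orthonormal.1]
  · intro j _ hj
    rw [h.orthonormal.2 hj, zero_smul]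
  · simp

/-- Keeping only the terms indexed by `s` gives an approximant of rank at most `s.card`. By
Pythagoras and Bessel's inequality the remaining terms have operator norm at most `C`. -/
theorem singularNumber_le (h : IsSingularDecomp a e g) (s : Finset κ) {C : ℝ} (hC : 0 ≤ C)
    (hs : ∀ i ∉ s, ‖g i‖ ≤ C) : singularNumber a s.card ≤ C := by
  classical
  let c : L →L[ℂ] L := ∑ i ∈ s, (innerSL ℂ (e i)).smulRight (g i)
  have hc : ∀ x, c x = ∑ i ∈ s, inner ℂ (e i) x • g i := fun x => by
    simp [c]
  refine (csInf_le (singularNumber_set_bddBelow a s.card) ⟨c, ?_, rfl⟩).trans ?_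
  · have hle : LinearMap.range (c : L →ₗ[ℂ] L) ≤ Submodule.span ℂ (s.image g : Set L) := by
      rintro _ ⟨x, rfl⟩
      change c x ∈ _
      rw [hc]
      refine Submodule.sum_mem _ fun i hi => Submodule.smul_mem _ _ (Submodule.subset_span ?_)
      exact Finset.mem_coe.2 (Finset.mem_image_of_mem _ hi)
    refine (Submodule.rank_mono hle).trans ((rank_span_finset_le _).trans ?_)
    exact_mod_cast Finset.card_image_le
  · refine ContinuousLinearMap.opNorm_le_bound _ hC fun x => ?_
    have hx : (a - c) x = ∑ i ∈ sᶜ, inner ℂ (e i) x • g i := by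
      rw [sub_apply, h.apply_eq, hc, ← Finset.sum_add_sum_compl s]
      simp
    refine le_of_sq_le_sq ?_ (by positivity)
    rw [hx, norm_sum_smul_sq h.orthogonal, mul_pow]
    calc ∑ i ∈ sᶜ, ‖inner ℂ (e i) x‖ ^ 2 * ‖g i‖ ^ 2
        ≤ ∑ i ∈ sᶜ, ‖inner ℂ (e i) x‖ ^ 2 * C ^ 2 := by
          refine Finset.sum_le_sum fun i hi => ?_
          have := hs i (Finset.mem_compl.1 hi)
          gcongr
      _ = C ^ 2 * ∑ i ∈ sᶜ, ‖inner ℂ (e i) x‖ ^ 2 := by rw [← Finset.sum_mul, mul_comm]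
      _ ≤ C ^ 2 * ‖x‖ ^ 2 := by
          gcongr
          exact h.orthonormal.sum_inner_products_le x

/-- An operator `c` of rank at most `n < s.card` kills a nonzero vector in the span of the `e i`, `i
∈ s`. On that span `a` stretches norms by at least `C`, so `‖a - c‖ ≥ C`. -/
theorem le_singularNumber (h : IsSingularDecomp a e g) (s : Finset κ) {C : ℝ} (hC : 0 ≤ C)
    (hs : ∀ i ∈ s, C ≤ ‖g i‖) {n : ℕ} (hn : n < s.card) : C ≤ singularNumber a n := by
  classical
  refine le_csInf ⟨_, 0, by simp, rfl⟩ ?_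
  rintro t ⟨c, hc, rfl⟩
  let T : (s → ℂ) →ₗ[ℂ] L := Fintype.linearCombination ℂ fun i : s => e i
  have hT : ∀ x : s → ℂ, T x = ∑ i : s, x i • e i := fun x => by
    simp [T, Fintype.linearCombination_apply]
  -- Dimension count: an injective composite would embed a space of dimension `s.card` into the
  -- range of `c`.
  have hni : ¬ Function.Injective ((c : L →ₗ[ℂ] L) ∘ₗ T) := fun hinj => by
    have h1 := LinearMap.lift_rank_le_of_injective
      ((c : L →ₗ[ℂ] L).rangeRestrict ∘ₗ T) fun x y hxy => hinj (congrArg Subtype.val hxy)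
    have h2 := h1.trans (Cardinal.lift_le.2 hc)
    rw [rank_fun'] at h2
    simp only [Cardinal.lift_natCast, Fintype.card_coe, Nat.cast_le] at h2
    omega
  obtain ⟨x, hx, hx0⟩ : ∃ x : s → ℂ, c (T x) = 0 ∧ x ≠ 0 := by
    rw [← LinearMap.ker_eq_bot, ← ne_eq, Submodule.ne_bot_iff] at hni
    exact hni
  have hTx : ‖T x‖ ^ 2 = ∑ i, ‖x i‖ ^ 2 := by
    rw [hT]
    exact norm_sum_smul_orthonormal_sq (h.orthonormal.comp _ Subtype.coe_injective) _ _
  have haTx : ‖a (T x)‖ ^ 2 = ∑ i, ‖x i‖ ^ 2 * ‖g i‖ ^ 2 := by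
    rw [hT, map_sum]
    simp only [map_smul, h.apply_left]
    exact norm_sum_smul_sq (g := fun i : s => g i)
      (fun i j hij => h.orthogonal (Subtype.coe_injective.ne hij)) _ _
  have hpos : 0 < ‖T x‖ := by
    obtain ⟨i, hi⟩ := Function.ne_iff.1 hx0
    refine lt_of_pow_lt_pow_left₀ 2 (norm_nonneg _) ?_
    rw [hTx, zero_pow two_ne_zero]
    exact Finset.sum_pos' (fun j _ => by positivity)
      ⟨i, Finset.mem_univ i, pow_pos (norm_pos_iff.2 hi) 2⟩
  have h1 : C * ‖T x‖ ≤ ‖a (T x)‖ := by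
    refine le_of_sq_le_sq ?_ (norm_nonneg _)
    rw [mul_pow, hTx, haTx, Finset.mul_sum]
    refine Finset.sum_le_sum fun i _ => ?_
    rw [mul_comm]
    have := hs i i.2
    gcongr
  have h2 : ‖a (T x)‖ ≤ ‖a - c‖ * ‖T x‖ := by
    have := (a - c).le_opNorm (T x)
    rwa [sub_apply, hx, sub_zero] at this
  exact le_of_mul_le_mul_right (h1.trans h2) hpos

theorem comp_equiv (h : IsSingularDecomp a e g) (σ : κ' ≃ κ) :
    IsSingularDecomp a (e ∘ σ) (g ∘ σ) where
  orthonormal := h.orthonormal.comp _ σ.injective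
  orthogonal i j hij := h.orthogonal (σ.injective.ne hij)
  apply_eq x := by
    rw [h.apply_eq, ← Equiv.sum_comp σ]
    rfl

/-- With the norms in decreasing order the two preceding bounds meet. The upper one uses the `n`
indices before `n`, the lower one the `n + 1` indices up to `n`. -/
theorem singularNumber_eq {N : ℕ} {e g : Fin N → L} (h : IsSingularDecomp a e g)
    (hg : Antitone fun i => ‖g i‖) (n : ℕ) :
    singularNumber a n = if hn : n < N then ‖g ⟨n, hn⟩‖ else 0 := by
  split_ifs with hn
  · refine le_antisymm ?_ ?_
    · have := h.singularNumber_le (Finset.Iio ⟨n, hn⟩) (norm_nonneg (g ⟨n, hn⟩))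
        fun i hi => hg (by simpa using hi)
      simpa using this
    · exact h.le_singularNumber (Finset.Iic ⟨n, hn⟩) (norm_nonneg _)
        (fun i hi => hg (by simpa using hi)) (by simp)
  · refine le_antisymm ?_ (singularNumber_nonneg _ _)
    -- Singular numbers decrease in the index, since more approximants are allowed, and the one at
    -- index `N` already vanishes: nothing is left outside `univ`.
    refine le_trans ?_ (h.singularNumber_le Finset.univ le_rfl (by simp))
    refine csInf_le_csInf (singularNumber_set_bddBelow a n) ⟨_, 0, by simp, rfl⟩ ?_
    rintro t ⟨c, hc, rfl⟩
    refine ⟨c, hc.trans ?_, rfl⟩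
    simpa using hn

theorem tsum_singularNumber_rpow (h : IsSingularDecomp a e g) {t : ℝ} (ht : 0 < t) :
    ∑' n, singularNumber a n ^ t = ∑ i, ‖g i‖ ^ t := by
  let f := g ∘ (Fintype.equivFin κ).symm
  -- `Tuple.sort` sorts increasingly; the sign makes the norms decrease.
  let τ : Fin (Fintype.card κ) ≃ κ :=
    (Tuple.sort fun i => -‖f i‖).trans (Fintype.equivFin κ).symm
  have hτ : Antitone fun i => ‖(g ∘ τ) i‖ := fun i j hij =>
    neg_le_neg_iff.1 (Tuple.monotone_sort (fun i => -‖f i‖) hij)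
  have h' := (h.comp_equiv τ).singularNumber_eq hτ
  rw [← Equiv.sum_comp τ, tsum_eq_sum (s := Finset.range (Fintype.card κ)),
    ← Fin.sum_univ_eq_sum_range (fun n => singularNumber a n ^ t)]
  · refine Finset.sum_congr rfl fun i _ => ?_
    rw [h', dif_pos i.2]
    rfl
  · intro n hn
    rw [h', dif_neg (by simpa using hn), Real.zero_rpow ht.ne']

theorem schattenNorm_eq {a : finiteRank L} (h : IsSingularDecomp (a : L →L[ℂ] L) e g) {p : ℝ≥0∞}
    (hp : 1 ≤ p) (hp' : p ≠ ∞) :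
    schattenNorm p a = (∑ i, ‖g i‖ ^ p.toReal) ^ (1 / p.toReal) := by
  rw [schattenNorm, if_neg hp',
    h.tsum_singularNumber_rpow (ENNReal.toReal_pos (zero_lt_one.trans_le hp).ne' hp')]

end IsSingularDecomp

/-- The orthogonal complement of the kernel is finite-dimensional, because `a` is injective on it
with finite-dimensional range. Let `A` be the restriction of `a` to it. An orthonormal eigenbasis of
`A* A` provides `e`, and `g` is its image under `A`; the `g i` are orthogonal because `⟪A x, A y⟫ =
⟪A* A x, y⟫`. -/
theorem exists_isSingularDecomp [CompleteSpace L] (a : finiteRank L) :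
    ∃ (n : ℕ) (e g : Fin n → L), IsSingularDecomp (a : L →L[ℂ] L) e g := by
  obtain ⟨a, ha⟩ := a
  rw [mem_finiteRank] at ha
  let K : Submodule ℂ L := LinearMap.ker (a : L →ₗ[ℂ] L)
  have hK : IsClosed (K : Set L) := a.isClosed_ker
  have : CompleteSpace K := hK.completeSpace_coe
  have : FiniteDimensional ℂ Kᗮ := by
    refine FiniteDimensional.of_injective
      (((a : L →ₗ[ℂ] L).rangeRestrict) ∘ₗ Kᗮ.subtype) ?_
    rw [← LinearMap.ker_eq_bot, LinearMap.ker_eq_bot']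
    intro m hm
    have h1 : (m : L) ∈ K := by
      have := congrArg Subtype.val hm
      simpa [K] using this
    exact Subtype.ext (Submodule.disjoint_def.1 K.orthogonal_disjoint _ h1 m.2)
  let A : Kᗮ →L[ℂ] L := a ∘L Kᗮ.subtypeL
  let T : Kᗮ →L[ℂ] Kᗮ := ContinuousLinearMap.adjoint A ∘L A
  have hT : (T : Kᗮ →ₗ[ℂ] Kᗮ).IsSymmetric :=
    (ContinuousLinearMap.isPositive_adjoint_comp_self A).isSymmetric
  let b := hT.eigenvectorBasis rfl
  have hAA : ∀ i j, inner ℂ (A (b i)) (A (b j)) = inner ℂ (T (b i)) (b j) := fun i j =>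
    (ContinuousLinearMap.adjoint_inner_left _ _ _).symm
  refine ⟨_, fun i => (b i : L), fun i => A (b i), ?_, ?_, ?_⟩
  · exact b.orthonormal.comp_linearIsometry Kᗮ.subtypeₗᵢ
  · intro i j hij
    have hb : T (b i) = (hT.eigenvalues rfl i : ℂ) • b i := hT.apply_eigenvectorBasis rfl i
    change inner ℂ (A (b i)) (A (b j)) = 0
    rw [hAA, hb, inner_smul_left, b.orthonormal.2 hij, mul_zero]
  · intro x
    let y : Kᗮ := Kᗮ.orthogonalProjectionOnto x
    have hy : a x = A y := by
      -- The difference lies in the double orthogonal complement of the kernel, which is the kernel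
      -- itself because it is closed.
      have : x - (y : L) ∈ K := by
        have := Kᗮ.sub_starProjection_mem_orthogonal x
        rwa [Submodule.orthogonal_orthogonal] at this
      have h2 : a (x - y) = 0 := this
      rw [map_sub, sub_eq_zero] at h2
      exact h2
    change a x = _
    rw [hy]
    conv_lhs => rw [← b.sum_repr' y, map_sum]
    refine Finset.sum_congr rfl fun i _ => ?_
    rw [map_smul]
    congr 1
    exact Kᗮ.inner_orthogonalProjectionOnto_eq_of_mem_left (b i) x

/-! ### Comparison of Schatten norms for different exponents. -/

theorem singularNumber_zero (a : L →L[ℂ] L) : singularNumber a 0 = ‖a‖ := by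
  refine le_antisymm (csInf_le (singularNumber_set_bddBelow a 0) ⟨0, by simp, by simp⟩)
    (le_csInf ⟨_, 0, by simp, rfl⟩ ?_)
  rintro t ⟨c, hc, rfl⟩
  have hc0 : c = 0 := by
    have h : Module.rank ℂ (LinearMap.range (c : L →ₗ[ℂ] L)) = 0 := by simpa using hc
    have h' := LinearMap.range_eq_bot.1 (Submodule.rank_eq_zero.1 h)
    exact ContinuousLinearMap.coe_injective h'
  simp [hc0]

theorem singularNumber_le_schattenNorm {p : ℝ≥0∞} (hp : 1 ≤ p) (hp' : p ≠ ∞) (a : finiteRank L)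
    (n : ℕ) : singularNumber (a : L →L[ℂ] L) n ≤ schattenNorm p a := by
  have hs : 0 < p.toReal := ENNReal.toReal_pos (zero_lt_one.trans_le hp).ne' hp'
  have hle := (summable_singularNumber_rpow hs a).le_tsum n
    fun m _ => Real.rpow_nonneg (singularNumber_nonneg _ _) _
  rw [schattenNorm, if_neg hp']
  calc singularNumber (a : L →L[ℂ] L) n
      = (singularNumber (a : L →L[ℂ] L) n ^ p.toReal) ^ (1 / p.toReal) := by
        rw [← Real.rpow_mul (singularNumber_nonneg _ _), mul_one_div_cancel hs.ne', Real.rpow_one]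
    _ ≤ _ := Real.rpow_le_rpow (Real.rpow_nonneg (singularNumber_nonneg _ _) _) hle (by positivity)

theorem schattenNorm_rpow {p : ℝ≥0∞} (hp : 1 ≤ p) (hp' : p ≠ ∞) (a : finiteRank L) :
    schattenNorm p a ^ p.toReal = ∑' n, singularNumber (a : L →L[ℂ] L) n ^ p.toReal := by
  have hs : 0 < p.toReal := ENNReal.toReal_pos (zero_lt_one.trans_le hp).ne' hp'
  rw [schattenNorm, if_neg hp', ← Real.rpow_mul
    (tsum_nonneg fun n => Real.rpow_nonneg (singularNumber_nonneg _ _) _),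
    one_div_mul_cancel hs.ne', Real.rpow_one]

/-- For finite exponents, write `s_n ^ r = s_n ^ p * s_n ^ (r - p)`, bound the last factor by `‖a‖_p
^ (r - p)` and sum. For `r = ∞` the operator norm is the singular number of index `0`. -/
theorem schattenNorm_antitone {p r : ℝ≥0∞} (hp : 1 ≤ p) (hpr : p ≤ r) (a : finiteRank L) :
    schattenNorm r a ≤ schattenNorm p a := by
  rcases eq_or_ne p ∞ with rfl | hp'
  · rw [top_le_iff.1 hpr]
  rcases eq_or_ne r ∞ with rfl | hr'
  · have h := singularNumber_le_schattenNorm hp hp' a 0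
    rw [singularNumber_zero] at h
    rwa [schattenNorm, if_pos rfl]
  have hs : 0 < p.toReal := ENNReal.toReal_pos (zero_lt_one.trans_le hp).ne' hp'
  have ht : 0 < r.toReal := ENNReal.toReal_pos (zero_lt_one.trans_le (hp.trans hpr)).ne' hr'
  have hst : p.toReal ≤ r.toReal := ENNReal.toReal_mono hr' hpr
  have hM := schattenNorm_nonneg p a
  refine (Real.rpow_le_rpow_iff (schattenNorm_nonneg r a) hM ht).1 ?_
  rw [schattenNorm_rpow (hp.trans hpr) hr']
  calc ∑' n, singularNumber (a : L →L[ℂ] L) n ^ r.toReal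
      ≤ ∑' n, singularNumber (a : L →L[ℂ] L) n ^ p.toReal *
          schattenNorm p a ^ (r.toReal - p.toReal) := by
        refine Summable.tsum_le_tsum (fun n => ?_) (summable_singularNumber_rpow ht a)
          ((summable_singularNumber_rpow hs a).mul_right _)
        have h0 := singularNumber_nonneg (a : L →L[ℂ] L) n
        calc _ = singularNumber (a : L →L[ℂ] L) n ^ p.toReal *
              singularNumber (a : L →L[ℂ] L) n ^ (r.toReal - p.toReal) := by
              rw [← Real.rpow_add_of_nonneg h0 hs.le (sub_nonneg.2 hst), add_sub_cancel]
          _ ≤ _ := mul_le_mul_of_nonneg_left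
              (Real.rpow_le_rpow h0 (singularNumber_le_schattenNorm hp hp' a n)
                (sub_nonneg.2 hst)) (Real.rpow_nonneg h0 _)
    _ = schattenNorm p a ^ r.toReal := by
        rw [tsum_mul_right, ← schattenNorm_rpow hp hp',
          ← Real.rpow_add_of_nonneg hM hs.le (sub_nonneg.2 hst), add_sub_cancel]

theorem rankOne_mem_finiteRank (x y : L) : InnerProductSpace.rankOne ℂ x y ∈ finiteRank L := by
  rw [mem_finiteRank]
  refine Submodule.finiteDimensional_of_le (S₂ := Submodule.span ℂ {x}) ?_
  rintro _ ⟨z, rfl⟩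
  exact Submodule.mem_span_singleton.2 ⟨_, (InnerProductSpace.rankOne_apply x y z).symm⟩

/-- The value does not depend on `p`, so this projection can fill either tensor factor at no cost.
-/
theorem schattenNorm_rankOne {e : L} (he : ‖e‖ = 1) {p : ℝ≥0∞} (hp : 1 ≤ p) :
    schattenNorm p ⟨_, rankOne_mem_finiteRank e e⟩ = 1 := by
  rcases eq_or_ne p ∞ with rfl | hp'
  · simp [schattenNorm, he]
  have h : IsSingularDecomp (InnerProductSpace.rankOne ℂ e e) (fun _ : Unit => e) fun _ => e :=
    ⟨⟨fun _ => he, fun i j hij => absurd (Subsingleton.elim i j) hij⟩,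
      fun i j hij => absurd (Subsingleton.elim i j) hij, fun x => by simp⟩
  rw [IsSingularDecomp.schattenNorm_eq h hp hp']
  simp [he]

/-! ### The operation `◇`: products of singular numbers, and compressions. -/

variable (ι : UniformSpace.Completion (L ⊗[ℂ] L) ≃ₗᵢ[ℂ] L)

theorem norm_diamondOp_le (a b : L →L[ℂ] L) : ‖diamondOp ι a b‖ ≤ ‖a‖ * ‖b‖ := by
  refine ContinuousLinearMap.opNorm_le_bound _ (by positivity) fun z => ?_
  obtain ⟨w, rfl⟩ := ι.surjective z
  induction w using UniformSpace.Completion.induction_on with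
  | hp =>
    exact isClosed_le (((diamondOp ι a b).continuous.comp ι.continuous).norm)
      (continuous_const.mul ι.continuous.norm)
  | ih x =>
    have h : diamondOp ι a b (ι x) = ι (TensorProduct.mapL a b x : L ⊗[ℂ] L) := by
      simp [diamondOp]
    rw [h, ι.norm_map, ι.norm_map, UniformSpace.Completion.norm_coe,
      UniformSpace.Completion.norm_coe]
    refine (ContinuousLinearMap.le_opNorm _ _).trans ?_
    gcongr
    exact TensorProduct.norm_mapL_le a b

theorem inner_map_tmul (x y x' y' : L) :
    inner ℂ (ι ((x ⊗ₜ[ℂ] y : L ⊗[ℂ] L))) (ι ((x' ⊗ₜ[ℂ] y' : L ⊗[ℂ] L)))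
      = inner ℂ x x' * inner ℂ y y' := by
  rw [ι.inner_map_map, UniformSpace.Completion.inner_coe, TensorProduct.inner_tmul]

theorem norm_map_tmul (x y : L) : ‖ι ((x ⊗ₜ[ℂ] y : L ⊗[ℂ] L))‖ = ‖x‖ * ‖y‖ := by
  rw [ι.norm_map, UniformSpace.Completion.norm_coe, TensorProduct.norm_tmul]

/-- Inner products of elementary tensors factor, so tensor products of orthonormal or orthogonal
families are again such families. -/
theorem IsSingularDecomp.diamondOp {a b : L →L[ℂ] L} {e g : κ → L} {e' g' : κ' → L}
    (ha : IsSingularDecomp a e g) (hb : IsSingularDecomp b e' g') :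
    IsSingularDecomp (diamondOp ι a b)
      (fun k : κ × κ' => ι ((e k.1 ⊗ₜ[ℂ] e' k.2 : L ⊗[ℂ] L)))
      (fun k : κ × κ' => ι ((g k.1 ⊗ₜ[ℂ] g' k.2 : L ⊗[ℂ] L))) where
  orthonormal := by
    refine ⟨fun k => by rw [norm_map_tmul, ha.orthonormal.1, hb.orthonormal.1, one_mul],
      fun k l hkl => ?_⟩
    change inner ℂ (ι _) (ι _) = 0
    rw [inner_map_tmul]
    by_cases h : k.1 = l.1
    · rw [hb.orthonormal.2 fun h' => hkl (Prod.ext h h'), mul_zero]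
    · rw [ha.orthonormal.2 h, zero_mul]
  orthogonal k l hkl := by
    change inner ℂ (ι _) (ι _) = 0
    rw [inner_map_tmul]
    by_cases h : k.1 = l.1
    · rw [hb.orthogonal fun h' => hkl (Prod.ext h h'), mul_zero]
    · rw [ha.orthogonal h, zero_mul]
  apply_eq := by
    -- The expansion is packaged as a bounded operator so that it need only be compared with `a ◇ b`
    -- on elementary tensors, whose span is dense.
    let B : L →L[ℂ] L := ∑ k : κ × κ',
      (innerSL ℂ (ι ((e k.1 ⊗ₜ[ℂ] e' k.2 : L ⊗[ℂ] L)))).smulRight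
        (ι ((g k.1 ⊗ₜ[ℂ] g' k.2 : L ⊗[ℂ] L)))
    have hB : ∀ x, B x = ∑ k : κ × κ', inner ℂ (ι ((e k.1 ⊗ₜ[ℂ] e' k.2 : L ⊗[ℂ] L))) x •
        ι ((g k.1 ⊗ₜ[ℂ] g' k.2 : L ⊗[ℂ] L)) := fun x => by simp [B]
    have key : PQ.diamondOp ι a b = B := by
      refine ext_diamond ι fun ξ η => ?_
      rw [hB, diamondOp_apply, ha.apply_eq, hb.apply_eq]
      let j : (L ⊗[ℂ] L) →ₗ[ℂ] L := ι.toLinearEquiv.toLinearMap ∘ₗ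
        (UniformSpace.Completion.toComplₗᵢ (𝕜 := ℂ) (E := L ⊗[ℂ] L)).toLinearMap
      change j _ = ∑ k : κ × κ', _ • j _
      simp only [inner_map_tmul, TensorProduct.sum_tmul, TensorProduct.tmul_sum, map_sum,
        TensorProduct.tmul_smul, ← TensorProduct.smul_tmul', map_smul, Finset.smul_sum,
        Fintype.sum_prod_type]
      rw [Finset.sum_comm]
      refine Finset.sum_congr rfl fun i _ => Finset.sum_congr rfl fun k _ => ?_
      rw [smul_smul, mul_comm]
    intro x
    rw [key, hB]

/-- For finite `p` this is an equality: the sum over pairs of `(‖g i‖ * ‖g' j‖) ^ p` is the product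
of the two sums. For `p = ∞` it is the norm bound for tensor products of operators. -/
theorem schattenNorm_diamond_le [CompleteSpace L] {p : ℝ≥0∞} (hp : 1 ≤ p) (a b : finiteRank L) :
    schattenNorm p (diamond ι a b) ≤ schattenNorm p a * schattenNorm p b := by
  rcases eq_or_ne p ∞ with rfl | hp'
  · simp only [schattenNorm, if_true]
    exact norm_diamondOp_le ι a b
  obtain ⟨m, e, g, h⟩ := exists_isSingularDecomp a
  obtain ⟨n, e', g', h'⟩ := exists_isSingularDecomp b
  have hab : IsSingularDecomp ((diamond ι a b : finiteRank L) : L →L[ℂ] L) _ _ := h.diamondOp ι h'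
  rw [hab.schattenNorm_eq hp hp', h.schattenNorm_eq hp hp', h'.schattenNorm_eq hp hp',
    ← Real.mul_rpow (by positivity) (by positivity)]
  refine le_of_eq ?_
  congr 1
  rw [Fintype.sum_prod_type, Finset.sum_mul_sum]
  refine Finset.sum_congr rfl fun i _ => Finset.sum_congr rfl fun j _ => ?_
  rw [norm_map_tmul, Real.mul_rpow (norm_nonneg _) (norm_nonneg _)]

/-- An isometry intertwining `c` with `d` compresses `d` to `c`. -/
theorem exists_sandwich_eq [CompleteSpace L] (S : L →ₗᵢ[ℂ] L) {c d : finiteRank L}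
    (h : ∀ ζ, (d : L →L[ℂ] L) (S ζ) = S ((c : L →L[ℂ] L) ζ)) :
    sandwich (ContinuousLinearMap.adjoint S.toContinuousLinearMap) S.toContinuousLinearMap d
      = c := by
  ext1
  refine ContinuousLinearMap.ext fun ζ => ?_
  change ContinuousLinearMap.adjoint S.toContinuousLinearMap ((d : L →L[ℂ] L) (S ζ)) = _
  rw [h]
  refine ext_inner_left ℂ fun v => ?_
  rw [ContinuousLinearMap.adjoint_inner_right]
  exact S.inner_map_map v _

theorem norm_adjoint_isometry_le [CompleteSpace L] (S : L →ₗᵢ[ℂ] L) :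
    ‖ContinuousLinearMap.adjoint S.toContinuousLinearMap‖ ≤ 1 := by
  rw [LinearIsometryEquiv.norm_map]
  exact S.norm_toContinuousLinearMap_le

/-- The isometry `ζ ↦ ι (e ⊗ ζ)`, for a unit vector `e`. -/
def tmulLeft {e : L} (he : ‖e‖ = 1) : L →ₗᵢ[ℂ] L where
  toLinearMap := ι.toLinearEquiv.toLinearMap ∘ₗ
    (UniformSpace.Completion.toComplₗᵢ (𝕜 := ℂ) (E := L ⊗[ℂ] L)).toLinearMap ∘ₗ
    TensorProduct.mk ℂ L L e
  norm_map' := fun ζ => by simp [he]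

/-- The isometry `ζ ↦ ι (ζ ⊗ e)`, for a unit vector `e`. -/
def tmulRight {e : L} (he : ‖e‖ = 1) : L →ₗᵢ[ℂ] L where
  toLinearMap := ι.toLinearEquiv.toLinearMap ∘ₗ
    (UniformSpace.Completion.toComplₗᵢ (𝕜 := ℂ) (E := L ⊗[ℂ] L)).toLinearMap ∘ₗ
    (TensorProduct.mk ℂ L L).flip e
  norm_map' := fun ζ => by simp [he]

theorem tmulLeft_apply {e : L} (he : ‖e‖ = 1) (ζ : L) :
    tmulLeft ι he ζ = ι ((e ⊗ₜ[ℂ] ζ : L ⊗[ℂ] L)) := rfl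

theorem tmulRight_apply {e : L} (he : ‖e‖ = 1) (ζ : L) :
    tmulRight ι he ζ = ι ((ζ ⊗ₜ[ℂ] e : L ⊗[ℂ] L)) := rfl

theorem compression_left [CompleteSpace L] {e : L} (he : ‖e‖ = 1) (c : finiteRank L) :
    sandwich (ContinuousLinearMap.adjoint (tmulLeft ι he).toContinuousLinearMap)
      (tmulLeft ι he).toContinuousLinearMap (diamond ι ⟨_, rankOne_mem_finiteRank e e⟩ c) = c :=
  exists_sandwich_eq _ fun ζ => by
    change diamondOp ι (InnerProductSpace.rankOne ℂ e e) c _ = _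
    rw [tmulLeft_apply, diamondOp_apply, tmulLeft_apply]
    simp [he, inner_self_eq_norm_sq_to_K]

theorem compression_right [CompleteSpace L] {e : L} (he : ‖e‖ = 1) (c : finiteRank L) :
    sandwich (ContinuousLinearMap.adjoint (tmulRight ι he).toContinuousLinearMap)
      (tmulRight ι he).toContinuousLinearMap (diamond ι c ⟨_, rankOne_mem_finiteRank e e⟩) = c :=
  exists_sandwich_eq _ fun ζ => by
    change diamondOp ι c (InnerProductSpace.rankOne ℂ e e) _ = _
    rw [tmulRight_apply, diamondOp_apply, tmulRight_apply]
    simp [he, inner_self_eq_norm_sq_to_K]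

end PQ

namespace PQ

/-! ### Reduction of both norms to single terms. -/

section RepNorm

variable {κ V : Type*} [AddCommGroup V] {value : κ → V} {cost : κ → ℝ}

theorem repNorm_le_cost (hcost : ∀ i, 0 ≤ cost i) (i : κ) :
    repNorm value cost (value i) ≤ cost i :=
  csInf_le (repCosts_bddBelow hcost _) ⟨1, fun _ => i, by simp, by simp⟩

/-- By subadditivity, a bound on the single terms passes to every representation and then to the
infimum. The case `C = 0` is separate because one divides by `C`. -/
theorem seminorm_le_mul_repNorm [Module ℂ V] (hne : ∀ U, (repCosts value cost U).Nonempty)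
    (Q : Seminorm ℂ V) {C : ℝ} (hC : 0 ≤ C) (h : ∀ i, Q (value i) ≤ C * cost i) (U : V) :
    Q U ≤ C * repNorm value cost U := by
  have key : ∀ t ∈ repCosts value cost U, Q U ≤ C * t := by
    rintro t ⟨n, i, rfl, rfl⟩
    rw [Finset.mul_sum]
    exact (Finset.le_sum_of_subadditive Q (map_zero Q).le (map_add_le_add Q) _ _).trans (Finset.sum_le_sum fun k _ => h _)
  rcases hC.eq_or_lt with rfl | hC
  · obtain ⟨t, ht⟩ := hne U
    simpa using key t ht
  · rw [← div_le_iff₀' hC]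
    refine le_csInf (hne U) fun t ht => ?_
    rw [div_le_iff₀' hC]
    exact key t ht

end RepNorm

variable {L : Type*} [NormedAddCommGroup L] [InnerProductSpace ℂ L]
  {X : Type*} [NormedAddCommGroup X] [NormedSpace ℂ X]
  {E F : Type*} [AddCommGroup E] [Module ℂ E] [AddCommGroup F] [Module ℂ F]

theorem amplify_bimul (φ : E →ₗ[ℂ] F) (a b : L →L[ℂ] L) (u : Amp L E) :
    amplify φ (bimul a b u) = bimul a b (amplify φ u) := by
  induction u using TensorProduct.induction_on with
  | zero => simp
  | add u v hu hv => simp only [map_add, hu, hv]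
  | tmul x e => rfl

theorem quantization_tmul_le (p : ℝ≥0∞) (hp : 1 ≤ p) (a : finiteRank L) (x : X) :
    (quantization L X p hp).toSeminorm (a ⊗ₜ[ℂ] x) ≤ schattenNorm p a * ‖x‖ :=
  repNorm_le_cost (value := fun i : finiteRank L × X => i.1 ⊗ₜ[ℂ] i.2)
    (fun _ => mul_nonneg (schattenNorm_nonneg p _) (norm_nonneg _)) (a, x)

/-- To bound a seminorm by a multiple of that of `^{(p)}X`, it is enough to consider elementary
tensors. -/
theorem seminorm_le_mul_quantization (p : ℝ≥0∞) (hp : 1 ≤ p) (Q : Seminorm ℂ (Amp L X)) {C : ℝ}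
    (hC : 0 ≤ C) (h : ∀ (a : finiteRank L) (x : X), Q (a ⊗ₜ[ℂ] x) ≤ C * (schattenNorm p a * ‖x‖))
    (U : Amp L X) : Q U ≤ C * (quantization L X p hp).toSeminorm U :=
  seminorm_le_mul_repNorm (projective_nonempty p) Q hC (fun i => h i.1 i.2) U

variable [CompleteSpace L] (ι : UniformSpace.Completion (L ⊗[ℂ] L) ≃ₗᵢ[ℂ] L)

/-- The map `(u, v) ↦ u ◇ v` is bilinear, so the projective norms allow a reduction to elementary
tensors in one variable at a time. There the bound is `‖a ◇ b‖_r ≤ ‖a‖_p ‖b‖_q` with `r = max p q`.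
-/
theorem quantization_diamondAmp_le (p q : ℝ≥0∞) (hp : 1 ≤ p) (hq : 1 ≤ q) (u v : Amp L ℂ) :
    (quantization L ℂ (max p q) (le_max_of_le_left hp)).toSeminorm
        (amplify (TensorProduct.lid ℂ ℂ).toLinearMap (diamondAmp ι u v))
      ≤ (quantization L ℂ q hq).toSeminorm v * (quantization L ℂ p hp).toSeminorm u := by
  set M := quantization L ℂ (max p q) (le_max_of_le_left hp)
  let Φ : Amp L (ℂ ⊗[ℂ] ℂ) →ₗ[ℂ] Amp L ℂ := amplify (TensorProduct.lid ℂ ℂ).toLinearMap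
  -- First `v` is held fixed, its seminorm serving as the constant; then `a ⊗ x` is held fixed and
  -- `v` varies.
  refine seminorm_le_mul_quantization p hp
    (M.toSeminorm.comp (Φ ∘ₗ (diamondAmp ι).flip v)) (apply_nonneg _ v) (fun a x => ?_) u
  rw [mul_comm]
  refine seminorm_le_mul_quantization q hq
    (M.toSeminorm.comp (Φ ∘ₗ diamondAmp ι (a ⊗ₜ[ℂ] x)))
    (mul_nonneg (schattenNorm_nonneg p a) (norm_nonneg x)) (fun b y => ?_) v
  have h : Φ (diamondAmp ι (a ⊗ₜ[ℂ] x) (b ⊗ₜ[ℂ] y)) = diamond ι a b ⊗ₜ[ℂ] (x * y) := by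
    rw [diamondAmp, amplify₂_tmul]
    simp [Φ, amplify]
  change M.toSeminorm (Φ (diamondAmp ι (a ⊗ₜ[ℂ] x) (b ⊗ₜ[ℂ] y))) ≤ _
  rw [h]
  calc M.toSeminorm (diamond ι a b ⊗ₜ[ℂ] (x * y))
      ≤ schattenNorm (max p q) (diamond ι a b) * ‖x * y‖ := quantization_tmul_le _ _ _ _
    _ ≤ (schattenNorm p a * schattenNorm q b) * ‖x * y‖ := by
        gcongr
        refine (schattenNorm_diamond_le ι (le_max_of_le_left hp) a b).trans ?_
        exact mul_le_mul (schattenNorm_antitone hp (le_max_left p q) a)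
          (schattenNorm_antitone hq (le_max_right p q) b) (schattenNorm_nonneg _ _)
          (schattenNorm_nonneg _ _)
    _ = _ := by rw [norm_mul]; ring

theorem pop_le_of_eq_bimul {N : PQSeminorm L E} {M : PQSeminorm L F} {a b : L →L[ℂ] L}
    (ha : ‖a‖ ≤ 1) (hb : ‖b‖ ≤ 1) {u : Amp L E} {v : Amp L F} {U : Amp L (E ⊗[ℂ] F)}
    (hU : U = bimul a b (diamondAmp ι u v)) :
    (pop ι N M).toSeminorm U ≤ N.toSeminorm u * M.toSeminorm v := by
  rw [hU]
  refine (repNorm_le_cost (popCost_nonneg N M) (a, u, v, b)).trans ?_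
  have hu : 0 ≤ N.toSeminorm u := apply_nonneg _ _
  have hv : 0 ≤ M.toSeminorm v := apply_nonneg _ _
  calc ‖a‖ * N.toSeminorm u * M.toSeminorm v * ‖b‖
      ≤ 1 * N.toSeminorm u * M.toSeminorm v * 1 := by gcongr
    _ = _ := by ring

/-- The projection `P` goes into the factor with the smaller exponent, leaving `c` to be measured
with the larger one; compression by an isometry recovers `c` from `P ◇ c` or `c ◇ P`. The vector `1
⊗ x` is the preimage of `x` under the canonical isomorphism. -/
theorem pop_tmul_le [Nontrivial L] (p q : ℝ≥0∞) (hp : 1 ≤ p) (hq : 1 ≤ q) (c : finiteRank L)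
    (x : ℂ) :
    (pop ι (quantization L ℂ p hp) (quantization L ℂ q hq)).toSeminorm (c ⊗ₜ[ℂ] (1 ⊗ₜ[ℂ] x))
      ≤ schattenNorm (max p q) c * ‖x‖ := by
  obtain ⟨e, he⟩ := exists_norm_eq L zero_le_one
  let P : finiteRank L := ⟨_, rankOne_mem_finiteRank e e⟩
  rcases le_total p q with hpq | hpq
  · rw [max_eq_right hpq]
    refine (pop_le_of_eq_bimul ι (norm_adjoint_isometry_le (tmulLeft ι he))
      (tmulLeft ι he).norm_toContinuousLinearMap_le (u := P ⊗ₜ[ℂ] 1) (v := c ⊗ₜ[ℂ] x) ?_).trans ?_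
    · rw [diamondAmp, amplify₂_tmul, bimul_tmul, compression_left]
      rfl
    · have h1 := quantization_tmul_le p hp P (1 : ℂ)
      rw [schattenNorm_rankOne he hp, norm_one, one_mul] at h1
      calc _ ≤ 1 * (schattenNorm q c * ‖x‖) :=
            mul_le_mul h1 (quantization_tmul_le q hq c x) (apply_nonneg _ _) zero_le_one
        _ = _ := one_mul _
  · rw [max_eq_left hpq]
    refine (pop_le_of_eq_bimul ι (norm_adjoint_isometry_le (tmulRight ι he))
      (tmulRight ι he).norm_toContinuousLinearMap_le (u := c ⊗ₜ[ℂ] 1) (v := P ⊗ₜ[ℂ] x) ?_).trans ?_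
    · rw [diamondAmp, amplify₂_tmul, bimul_tmul, compression_right]
      rfl
    · have h1 := quantization_tmul_le p hp c (1 : ℂ)
      have h2 := quantization_tmul_le q hq P x
      rw [norm_one, mul_one] at h1
      rw [schattenNorm_rankOne he hq, one_mul] at h2
      exact mul_le_mul h1 h2 (apply_nonneg _ _) (schattenNorm_nonneg _ _)

end PQ
end

/-! ### The two inequalities for the canonical isomorphism. -/

theorem corollary6p3 {L : Type*} [NormedAddCommGroup L] [InnerProductSpace ℂ L] [CompleteSpace L]
    [TopologicalSpace.SeparableSpace L] (hL : ¬ FiniteDimensional ℂ L)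
    (ι : UniformSpace.Completion (L ⊗[ℂ] L) ≃ₗᵢ[ℂ] L)
    (p q : ℝ≥0∞) (hp : 1 ≤ p) (hq : 1 ≤ q) :
    PQ.IsCompletelyIsometricIso
      (PQ.pop ι (PQ.quantization L ℂ p hp) (PQ.quantization L ℂ q hq))
      (PQ.quantization L ℂ (max p q) (le_max_of_le_left hp))
      (TensorProduct.lid ℂ ℂ) := by
  have : Nontrivial L := by
    by_contra h
    rw [not_nontrivial_iff_subsingleton] at h
    exact hL inferInstance
  intro U
  set N := PQ.pop ι (PQ.quantization L ℂ p hp) (PQ.quantization L ℂ q hq)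
  set M := PQ.quantization L ℂ (max p q) (le_max_of_le_left hp)
  let Φ : PQ.Amp L (ℂ ⊗[ℂ] ℂ) →ₗ[ℂ] PQ.Amp L ℂ :=
    PQ.amplify (TensorProduct.lid ℂ ℂ).toLinearMap
  let Ψ : PQ.Amp L ℂ →ₗ[ℂ] PQ.Amp L (ℂ ⊗[ℂ] ℂ) :=
    PQ.amplify (TensorProduct.lid ℂ ℂ).symm.toLinearMap
  refine le_antisymm ?_ ?_
  -- The seminorm pulled back along `Φ` is compared with the cost of a single term `a · (u ◇ v) ·
  -- b`.
  · have h := PQ.seminorm_le_mul_repNorm (PQ.popCosts_nonempty ι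
        (PQ.quantization L ℂ p hp) (PQ.quantization L ℂ q hq))
      (M.toSeminorm.comp Φ) zero_le_one (fun i => ?_) U
    · rwa [one_mul] at h
    obtain ⟨a, u, v, b⟩ := i
    rw [one_mul]
    change M.toSeminorm (Φ (PQ.bimul a b (PQ.diamondAmp ι u v))) ≤ _
    rw [PQ.amplify_bimul]
    calc _ ≤ ‖a‖ * M.toSeminorm (Φ (PQ.diamondAmp ι u v)) * ‖b‖ := M.contractive' a b _
      _ ≤ ‖a‖ * ((PQ.quantization L ℂ q hq).toSeminorm v *
          (PQ.quantization L ℂ p hp).toSeminorm u) * ‖b‖ := by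
          gcongr
          exact PQ.quantization_diamondAmp_le ι p q hp hq u v
      _ = _ := by
          rw [PQ.popCost]
          ring
  -- The bound for `N ∘ Ψ` on elementary tensors is applied at `Φ U`; since `Ψ` inverts `Φ`, it
  -- bounds `N` at `U` itself.
  · have h := PQ.seminorm_le_mul_quantization (max p q) (le_max_of_le_left hp)
      (N.toSeminorm.comp Ψ) zero_le_one (fun c x => ?_) (Φ U)
    · have hΨ : Ψ (Φ U) = U := by
        change ((TensorProduct.lid ℂ ℂ).symm.toLinearMap.lTensor _ ∘ₗ
          (TensorProduct.lid ℂ ℂ).toLinearMap.lTensor _) U = U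
        rw [← LinearMap.lTensor_comp]
        simp
      rw [one_mul, Seminorm.comp_apply, hΨ] at h
      exact h
    · rw [one_mul]
      exact PQ.pop_tmul_le ι p q hp hq c x
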